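/- Let $k$ be a field, let $t\ge 1$ and let $n_1,\dots,n_t\ge 1$ be integers. Let $S=k[y_{i,j} : 1\le i\le t,\ 1\le j\le n_i+1]$ be the standard graded polynomial ring, and let $R=R(n_1,\dots,n_t)=S/I$ be the rational normal scroll of type $(n_1,\dots,n_t)$, where $I$ is the ideal generated by the $2$-minors of the $2\times(n_1+\cdots+n_t)$ matrix whose columns are $\binom{y_{i,j}}{y_{i,j+1}}$ for $1\le i\le t$, $1\le j\le n_i$. The residue classes in $R$ of the variables $y_{i,j}$ are called the natural coordinates of $R$. For a finitely generated graded $R$-module $M$ with minimal graded free resolution $\cdots\to F_1\to F_0\to M\to 0$, let $$\operatorname{reg}_R M=\sup\{\,j-i : F_i \text{ has a basis element of degree } j\,\}$$ be its Castelnuovo–Mumford regularity over $R$ (equivalently, $\sup\{j-i:\operatorname{Tor}^R_i(M,k)_j\neq 0\}$). Then $\operatorname{reg}_R R/(Y)=0$ for every subset $Y$ of the set of natural coordinates of $R$ if and only if $n_1=n_2=\cdots=n_t$. -/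

import Mathlib

noncomputable section

universe u v w

section Regularity

variable {k : Type u} {A : Type v} [CommRing k] [CommRing A] [Algebra k A]

/-- The graded pieces of `A ⧸ I`: the images of the graded pieces of `A`. -/
def quotientGrading (𝒜 : ℤ → Submodule k A) (I : Ideal A) : ℤ → Submodule k (A ⧸ I) :=
  fun j => (𝒜 j).map (Ideal.Quotient.mkₐ k I).toLinearMap

/-- The ideal generated by all homogeneous elements of positive degree. -/
def positiveIdeal (𝒜 : ℤ → Submodule k A) : Ideal A :=
  Ideal.span {a | ∃ j : ℤ, 0 < j ∧ a ∈ 𝒜 j}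

/-- A minimal graded free resolution
`⋯ → F₂ → F₁ → F₀ → M → 0` of a graded module `M` (with graded pieces `ℳ j`) over a graded ring `A`
(with graded pieces `𝒜 j`). The module `F i` is `⨁ b, A(-deg i b)`, a free module of finite rank
whose basis vector number `b` has degree `deg i b`. All maps are homogeneous of degree `0`, and the
matrices of the differentials have their entries in the ideal of elements of positive degree. -/
structure MinimalGradedFreeResolution (𝒜 : ℤ → Submodule k A) {M : Type w} [AddCommGroup M]
    [Module A M] [Module k M] (ℳ : ℤ → Submodule k M) where
  rank : ℕ → ℕ
  deg : (i : ℕ) → Fin (rank i) → ℤ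
  aug : (Fin (rank 0) → A) →ₗ[A] M
  d : (i : ℕ) → (Fin (rank (i + 1)) → A) →ₗ[A] (Fin (rank i) → A)
  aug_surjective : Function.Surjective aug
  exact_aug : Function.Exact (d 0) aug
  exact_d : ∀ i, Function.Exact (d (i + 1)) (d i)
  aug_homogeneous : ∀ b, aug (Pi.single b 1) ∈ ℳ (deg 0 b)
  d_homogeneous : ∀ i b c, d i (Pi.single b 1) c ∈ 𝒜 (deg (i + 1) b - deg i c)
  d_minimal : ∀ i b c, d i (Pi.single b 1) c ∈ positiveIdeal 𝒜

/-- The relative Castelnuovo-Mumford regularity `reg_A M`: the supremum of the numbers `j - i` such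
that the `i`-th module of the minimal graded free resolution of `M` over `A` has a basis element of
degree `j`. It is `⊥` for the zero module and `⊤` if the numbers `j - i` are unbounded.
(The minimal graded free resolution is unique up to isomorphism, so that the supremum over all
of them is the value at any one of them.) -/
def castelnuovoMumfordRegularity (𝒜 : ℤ → Submodule k A) {M : Type w} [AddCommGroup M]
    [Module A M] [Module k M] (ℳ : ℤ → Submodule k M) : EReal :=
  sSup {x | ∃ (F : MinimalGradedFreeResolution 𝒜 ℳ) (i : ℕ) (b : Fin (F.rank i)),
    x = (((F.deg i b - (i : ℤ) : ℤ) : ℝ) : EReal)}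

end Regularity

section Scroll

/-- The standard `ℤ`-grading of a polynomial ring. -/
def polynomialGrading (σ : Type v) (k : Type u) [CommRing k] :
    ℤ → Submodule k (MvPolynomial σ k)
  | Int.ofNat m => MvPolynomial.homogeneousSubmodule σ k m
  | Int.negSucc _ => ⊥

/-- The ideal `I₂(X)` generated by the `2`-minors of a `2 × e` matrix. -/
def idealOfTwoMinors {A : Type v} [CommRing A] {κ : Type w} (X : Matrix (Fin 2) κ A) : Ideal A :=
  Ideal.span {f | ∃ c c' : κ, f = (X.submatrix id ![c, c']).det}

/-- Indices of the variables `y_{i,1}, …, y_{i,n_i+1}`, numbered from `0`. -/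
abbrev ScrollVar {t : ℕ} (n : Fin t → ℕ) : Type := (i : Fin t) × Fin (n i + 1)

/-- The matrix whose `i`-th block has the columns `(y_{i,j}, y_{i,j+1})`, `j = 1, …, n_i`. -/
def scrollMatrix (k : Type u) [CommRing k] {t : ℕ} (n : Fin t → ℕ) :
    Matrix (Fin 2) ((i : Fin t) × Fin (n i)) (MvPolynomial (ScrollVar n) k) :=
  Matrix.of ![fun c => MvPolynomial.X ⟨c.1, c.2.castSucc⟩,
    fun c => MvPolynomial.X ⟨c.1, c.2.succ⟩]

/-- The (homogeneous coordinate ring of the) rational normal scroll of type `n`. -/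
abbrev Scroll (k : Type u) [CommRing k] {t : ℕ} (n : Fin t → ℕ) : Type u :=
  MvPolynomial (ScrollVar n) k ⧸ idealOfTwoMinors (scrollMatrix k n)

def scrollGrading (k : Type u) [CommRing k] {t : ℕ} (n : Fin t → ℕ) :
    ℤ → Submodule k (Scroll k n) :=
  quotientGrading (polynomialGrading (ScrollVar n) k) (idealOfTwoMinors (scrollMatrix k n))

/-- The residue classes of the variables `y_{i,j}` in the scroll. -/
def naturalCoordinates (k : Type u) [CommRing k] {t : ℕ} (n : Fin t → ℕ) : Set (Scroll k n) :=
  Set.range fun v : ScrollVar n => Ideal.Quotient.mk _ (MvPolynomial.X v)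

end Scroll

end

/-!
A ring `A` generated by a finite set `V` of linear forms is strongly Koszul with respect to `V` if
the colon ideals `(Y) : y`, for `Y ⊆ V` and `y ∈ V`, `y ∉ Y`, are again generated by subsets of `V`.
In this case `(Y)` has linear quotients, i.e. linear generators whose successive colon ideals are
generated by subsets of `V`, and linear quotients are inherited by the syzygy module of these
generators. This makes `A ⧸ (Y)` the end of a linear minimal resolution, and by the uniqueness of
minimal resolutions its regularity is `0`.

The scroll is the monoid algebra of the monoid of pairs (multiset `α` of blocks, natural number `a`)
with `a ≤ ∑ i ∈ α, n i`: by the minors, only the blocks of the variables of a monomial and the sum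
of their positions matter. Its ideals of coordinates and their colon ideals are spanned by
monomials. If all `n i` are equal, an inspection of the inequalities shows that such a colon ideal
is generated by coordinates. If `n l < n i`, let `y`, `y'` be the first and the last coordinate of
block `i` and `u` the last coordinate of block `l`. Then `u ^ n i` lies in `(y') : y`, but no
monomial of degree at most `1` that divides it does, so that the syzygies of `y, y'` are not
generated by linear ones, and the regularity of the quotient by `(y, y')` is positive.
-/

noncomputable section

universe u v w

section GradedCovers

variable {k : Type u} {A : Type v} [CommRing k] [CommRing A] [Algebra k A]

theorem mem_positiveIdeal_of_mem {𝒜 : ℤ → Submodule k A} {j : ℤ} (hj : 0 < j) {a : A}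
    (ha : a ∈ 𝒜 j) : a ∈ positiveIdeal 𝒜 :=
  Ideal.subset_span ⟨j, hj, ha⟩

variable (𝒜 : ℤ → Submodule k A)

theorem proj_eq_zero_of_mem_positiveIdeal [GradedAlgebra 𝒜] (hneg : ∀ j < 0, 𝒜 j = ⊥) {j : ℤ}
    (hj : j ≤ 0) {a : A} (ha : a ∈ positiveIdeal 𝒜) : GradedAlgebra.proj 𝒜 j a = 0 := by
  suffices h : ∀ r : A, GradedAlgebra.proj 𝒜 j (r * a) = 0 by simpa using h 1
  induction ha using Submodule.span_induction with
  | mem x hx =>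
    obtain ⟨i, hi, hx⟩ := hx
    intro r
    have hr : GradedAlgebra.proj 𝒜 (j - i) r = 0 := by
      simpa [hneg (j - i) (by omega)] using SetLike.coe_mem (DirectSum.decompose 𝒜 r (j - i))
    have := DirectSum.coe_decompose_mul_add_of_right_mem 𝒜 (i := j - i) (a := r) hx
    rw [sub_add_cancel] at this
    exact this.trans (by rw [← GradedAlgebra.proj_apply, hr, zero_mul])
  | zero => simp
  | add x y _ _ hx hy => intro r; rw [mul_add, map_add, hx, hy, add_zero]
  | smul s x _ hx => intro r; rw [smul_eq_mul, ← mul_assoc, hx]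

theorem eq_zero_of_mem_positiveIdeal [GradedAlgebra 𝒜] (hneg : ∀ j < 0, 𝒜 j = ⊥) {j : ℤ}
    (hj : j ≤ 0) {a : A} (ha : a ∈ positiveIdeal 𝒜) (haj : a ∈ 𝒜 j) : a = 0 := by
  rw [← DirectSum.decompose_of_mem_same 𝒜 haj, ← GradedAlgebra.proj_apply,
    proj_eq_zero_of_mem_positiveIdeal 𝒜 hneg hj ha]

theorem span_le_positiveIdeal {Y : Set A} (hY : Y ⊆ 𝒜 1) : Ideal.span Y ≤ positiveIdeal 𝒜 :=
  Ideal.span_le.2 fun _ hy => mem_positiveIdeal_of_mem one_pos (hY hy)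

theorem iSupIndep_of_projections {ι M : Type*} [AddCommGroup M] [Module k M]
    {N : ι → Submodule k M} (π : ι → M →ₗ[k] M) (hself : ∀ i, ∀ x ∈ N i, π i x = x)
    (hne : ∀ i j, j ≠ i → ∀ x ∈ N j, π i x = 0) : iSupIndep N := by
  refine fun i => Submodule.disjoint_def.2 fun x hx hx' => ?_
  have hker : ⨆ j ≠ i, N j ≤ LinearMap.ker (π i) := iSup₂_le fun j hj x hx => hne i j hj x hx
  rw [← hself i x hx]
  exact hker hx'

theorem iSupIndep_quotientGrading [GradedAlgebra 𝒜] {I : Ideal A} (hI : I.IsHomogeneous 𝒜) :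
    iSupIndep (quotientGrading 𝒜 I) := by
  refine fun j => Submodule.disjoint_def.2 ?_
  rintro _ ⟨a, ha, rfl⟩ h
  simp only [quotientGrading, ← Submodule.map_iSup] at h
  obtain ⟨b, hb, hab⟩ := h
  have hker : ⨆ i ≠ j, 𝒜 i ≤ LinearMap.ker (GradedAlgebra.proj 𝒜 j) :=
    iSup₂_le fun i hi x hx => DirectSum.decompose_of_mem_ne 𝒜 hx hi
  have hproj : GradedAlgebra.proj 𝒜 j (a - b) = a := by
    rw [map_sub, LinearMap.mem_ker.1 (hker hb), sub_zero]
    exact DirectSum.decompose_of_mem_same 𝒜 ha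
  have hmem : a - b ∈ I := Ideal.Quotient.eq.1 hab.symm
  exact Ideal.Quotient.eq_zero_iff_mem.2 (hproj ▸ hI j hmem)

instance gradedSMul_quotientGrading [SetLike.GradedMonoid 𝒜] (I : Ideal A) :
    SetLike.GradedSMul 𝒜 (quotientGrading 𝒜 I) where
  smul_mem := by
    rintro i j a _ ha ⟨b, hb, rfl⟩
    exact ⟨a * b, SetLike.mul_mem_graded ha hb, map_mul (Ideal.Quotient.mk I) a b⟩

/-- The graded pieces of the graded free module `⨁ c, A(-ε c)`, whose basis vector number `c` has
degree `ε c`. -/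
def freeGrading {γ : Type*} (ε : γ → ℤ) (j : ℤ) : Submodule k (γ → A) :=
  Submodule.pi Set.univ fun c => 𝒜 (j - ε c)

variable {𝒜} {β γ : Type*}

theorem mem_freeGrading {ε : γ → ℤ} {j : ℤ} {x : γ → A} :
    x ∈ freeGrading 𝒜 ε j ↔ ∀ c, x c ∈ 𝒜 (j - ε c) := by
  simp [freeGrading]

theorem single_mem_freeGrading [SetLike.GradedOne 𝒜] [DecidableEq γ] (ε : γ → ℤ) (c : γ) :
    Pi.single c 1 ∈ freeGrading 𝒜 ε (ε c) := by
  refine mem_freeGrading.2 fun c' => ?_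
  rcases eq_or_ne c' c with rfl | hc
  · simpa using SetLike.GradedOne.one_mem (A := 𝒜)
  · simp [hc]

instance gradedSMul_freeGrading [SetLike.GradedMonoid 𝒜] (ε : γ → ℤ) :
    SetLike.GradedSMul 𝒜 (freeGrading 𝒜 ε) where
  smul_mem := by
    intro i j a x ha hx
    refine mem_freeGrading.2 fun c => ?_
    rw [vadd_eq_add, add_sub_assoc]
    exact SetLike.mul_mem_graded ha (mem_freeGrading.1 hx c)

theorem iSupIndep_freeGrading [GradedAlgebra 𝒜] (ε : γ → ℤ) : iSupIndep (freeGrading 𝒜 ε) := by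
  refine iSupIndep_of_projections
    (fun j => LinearMap.pi fun c => GradedAlgebra.proj 𝒜 (j - ε c) ∘ₗ LinearMap.proj c) ?_ ?_
  · exact fun j x hx => funext fun c =>
      DirectSum.decompose_of_mem_same 𝒜 (mem_freeGrading.1 hx c)
  · exact fun j i hij x hx => funext fun c =>
      DirectSum.decompose_of_mem_ne 𝒜 (mem_freeGrading.1 hx c) (by omega)

variable {M : Type*} [AddCommGroup M] [Module A M] [Module k M] {ℳ : ℤ → Submodule k M}

theorem sub_proj_smul_mem_iSup [GradedAlgebra 𝒜] [SetLike.GradedSMul 𝒜 ℳ] {i j : ℤ} (a : A) {m : M}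
    (hm : m ∈ ℳ j) : (a - GradedAlgebra.proj 𝒜 i a) • m ∈ ⨆ l ≠ i + j, ℳ l := by
  induction a using DirectSum.Decomposition.inductionOn 𝒜 with
  | zero => simp
  | @homogeneous l a =>
    rcases eq_or_ne l i with rfl | hl
    · simp [GradedAlgebra.proj_apply]
    · rw [GradedAlgebra.proj_apply, DirectSum.decompose_of_mem_ne 𝒜 a.2 hl, sub_zero]
      exact Submodule.mem_iSup_of_mem (l + j) (Submodule.mem_iSup_of_mem (by omega)
        (SetLike.GradedSMul.smul_mem a.2 hm))
  | add a b ha hb =>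
    rw [map_add, add_sub_add_comm, add_smul]
    exact add_mem ha hb

variable [DecidableEq β] [DecidableEq γ]

theorem linearMap_apply_eq_sum [Fintype γ] (f : (γ → A) →ₗ[A] M) (x : γ → A) :
    f x = ∑ c, x c • f (Pi.single c 1) := by
  conv_lhs => rw [pi_eq_sum_univ' x]
  simp [map_sum]

/-- An `A`-linear map from the graded free module `⨁ b, A(-δ b)` to a graded module is homogeneous
of degree `0`; it is enough to test this on the basis. -/
def IsGradedMap (ℳ : ℤ → Submodule k M) (δ : β → ℤ) (p : (β → A) →ₗ[A] M) : Prop :=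
  ∀ b, p (Pi.single b 1) ∈ ℳ (δ b)

namespace IsGradedMap

variable [Finite γ] {δ : β → ℤ} {ε : γ → ℤ} {p : (β → A) →ₗ[A] M} {q : (γ → A) →ₗ[A] M}

theorem apply_mem [SetLike.GradedSMul 𝒜 ℳ] (hq : IsGradedMap ℳ ε q) {j : ℤ} {x : γ → A}
    (hx : x ∈ freeGrading 𝒜 ε j) : q x ∈ ℳ j := by
  have := Fintype.ofFinite γ
  rw [linearMap_apply_eq_sum]
  refine sum_mem fun c _ => ?_
  simpa using SetLike.GradedSMul.smul_mem (mem_freeGrading.1 hx c) (hq c)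

theorem comp [SetLike.GradedSMul 𝒜 ℳ] (hq : IsGradedMap ℳ ε q) {f : (β → A) →ₗ[A] (γ → A)}
    (hf : IsGradedMap (freeGrading 𝒜 ε) δ f) : IsGradedMap ℳ δ (q ∘ₗ f) :=
  fun b => hq.apply_mem (hf b)

variable [GradedAlgebra 𝒜]

theorem exists_mem_freeGrading_of_mem_range [SetLike.GradedSMul 𝒜 ℳ] (hℳ : iSupIndep ℳ)
    (hq : IsGradedMap ℳ ε q) {j : ℤ} {x : M} (hx : x ∈ ℳ j) (hxq : x ∈ LinearMap.range q) :
    ∃ a ∈ freeGrading 𝒜 ε j, q a = x := by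
  have := Fintype.ofFinite γ
  obtain ⟨a, rfl⟩ := hxq
  let a' : γ → A := fun c => GradedAlgebra.proj 𝒜 (j - ε c) (a c)
  have ha' : a' ∈ freeGrading 𝒜 ε j := mem_freeGrading.2 fun c => SetLike.coe_mem _
  have hoff : q (a - a') ∈ ⨆ l ≠ j, ℳ l := by
    rw [linearMap_apply_eq_sum]
    refine sum_mem fun c _ => ?_
    have hc := sub_proj_smul_mem_iSup (𝒜 := 𝒜) (i := j - ε c) (a c) (hq c)
    rw [sub_add_cancel] at hc
    exact hc
  have hon : q (a - a') ∈ ℳ j := by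
    rw [map_sub]
    exact sub_mem hx (hq.apply_mem ha')
  refine ⟨a', ha', ?_⟩
  rw [eq_comm, ← sub_eq_zero, ← map_sub]
  exact Submodule.disjoint_def.1 (hℳ j) _ hon hoff

theorem symm (e : (γ → A) ≃ₗ[A] (β → A))
    (he : IsGradedMap (freeGrading 𝒜 δ) ε (e : (γ → A) →ₗ[A] (β → A))) :
    IsGradedMap (freeGrading 𝒜 ε) δ (e.symm : (β → A) →ₗ[A] (γ → A)) := by
  intro b
  obtain ⟨a, ha, hab⟩ := he.exists_mem_freeGrading_of_mem_range (𝒜 := 𝒜) (iSupIndep_freeGrading δ)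
    (single_mem_freeGrading δ b) ⟨e.symm (Pi.single b 1), e.apply_symm_apply _⟩
  rwa [← hab, LinearEquiv.coe_coe, LinearEquiv.coe_coe, e.symm_apply_apply]

variable [Finite β]

theorem exists_comp_eq [SetLike.GradedSMul 𝒜 ℳ] (hℳ : iSupIndep ℳ) (hp : IsGradedMap ℳ δ p)
    (hq : IsGradedMap ℳ ε q) (hle : LinearMap.range p ≤ LinearMap.range q) :
    ∃ f : (β → A) →ₗ[A] (γ → A), IsGradedMap (freeGrading 𝒜 ε) δ f ∧ q ∘ₗ f = p := by
  have := Fintype.ofFinite β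
  choose a ha haq using fun b =>
    hq.exists_mem_freeGrading_of_mem_range (𝒜 := 𝒜) hℳ (hp b) (hle (LinearMap.mem_range_self p _))
  refine ⟨Fintype.linearCombination A a, fun b => ?_, LinearMap.pi_ext' fun b => ?_⟩
  · simpa [Fintype.linearCombination_apply_single] using ha b
  · ext
    simp [Fintype.linearCombination_apply_single, haq]

/-- In a diagonal entry `1 = ∑ c, e c b * e⁻¹ b c` of the product of the matrices of `e⁻¹` and `e`,
the two factors of each summand have opposite degrees, so some summand has both degrees `0`. -/
theorem exists_degree_eq [Nontrivial A] (hneg : ∀ j < 0, 𝒜 j = ⊥) {κ : Type*} [Finite κ]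
    {η : κ → ℤ} (e : (β → A) ≃ₗ[A] (κ → A))
    (he : IsGradedMap (freeGrading 𝒜 η) δ (e : (β → A) →ₗ[A] (κ → A))) (b : β) :
    ∃ c, η c = δ b := by
  classical
  have := Fintype.ofFinite κ
  by_contra! hne
  have hentry : (1 : A) = ∑ c, e (Pi.single b 1) c * e.symm (Pi.single c 1) b := by
    have h := congrFun (linearMap_apply_eq_sum (e.symm : (κ → A) →ₗ[A] (β → A))
      (e (Pi.single b 1))) b
    simpa [Finset.sum_apply] using h
  refine one_ne_zero (hentry.trans (Finset.sum_eq_zero fun c _ => ?_))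
  rcases (hne c).lt_or_gt with hlt | hlt
  · have h := mem_freeGrading.1 (symm e he c) b
    rw [hneg _ (by omega), Submodule.mem_bot] at h
    exact mul_eq_zero_of_right _ h
  · have h := mem_freeGrading.1 (he b) c
    rw [hneg _ (by omega), Submodule.mem_bot] at h
    exact mul_eq_zero_of_left h _

theorem bijective_of_sub_mem_positiveIdeal (hneg : ∀ j < 0, 𝒜 j = ⊥)
    {h : (β → A) →ₗ[A] (β → A)} (hh : IsGradedMap (freeGrading 𝒜 δ) δ h)
    (hmin : ∀ b c, (Pi.single b 1 - h (Pi.single b 1) : β → A) c ∈ positiveIdeal 𝒜) :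
    Function.Bijective h := by
  have := Fintype.ofFinite β
  have hbasis : ∀ b, Pi.single b 1 ∈ LinearMap.range h := by
    intro b
    induction b using (Finite.wellFounded_of_trans_of_irrefl (InvImage (· < ·) δ)).induction with
    | _ b ih =>
    set y := Pi.single b 1 - h (Pi.single b 1) with hy
    have hy_mem : y ∈ freeGrading 𝒜 δ (δ b) := sub_mem (single_mem_freeGrading δ b) (hh b)
    have hy_range : y ∈ LinearMap.range h := by
      rw [pi_eq_sum_univ' y]
      refine sum_mem fun c _ => ?_
      rcases lt_or_ge (δ c) (δ b) with hc | hc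
      · exact Submodule.smul_mem _ _ (ih c hc)
      · have hyc : y c = 0 := eq_zero_of_mem_positiveIdeal 𝒜 hneg (by omega) (hmin b c)
          (mem_freeGrading.1 hy_mem c)
        rw [hyc, zero_smul]
        exact zero_mem _
    rw [← sub_add_cancel (Pi.single b 1) (h (Pi.single b 1)), ← hy]
    exact add_mem hy_range (LinearMap.mem_range_self h _)
  have hsurj : Function.Surjective h := by
    rw [← LinearMap.range_eq_top, eq_top_iff, ← (Pi.basisFun A β).span_eq, Submodule.span_le]
    rintro _ ⟨b, rfl⟩
    simpa using hbasis b
  exact ⟨OrzechProperty.injective_of_surjective_endomorphism h hsurj, hsurj⟩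

end IsGradedMap

/-- A homogeneous map from `⨁ b, A(-δ b)` that becomes injective modulo the ideal of elements of
positive degree, i.e. the given basis is a minimal generating system of the image. -/
structure IsMinimalGradedCover (𝒜 : ℤ → Submodule k A) (ℳ : ℤ → Submodule k M) (δ : β → ℤ)
    (p : (β → A) →ₗ[A] M) : Prop where
  isGradedMap : IsGradedMap ℳ δ p
  mem_positiveIdeal : ∀ x ∈ LinearMap.ker p, ∀ b, x b ∈ positiveIdeal 𝒜

namespace IsMinimalGradedCover

variable [Finite β] [Finite γ] [GradedAlgebra 𝒜] {δ : β → ℤ} {ε : γ → ℤ}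
  {p : (β → A) →ₗ[A] M} {q : (γ → A) →ₗ[A] M}

theorem bijective_of_comp_eq (hneg : ∀ j < 0, 𝒜 j = ⊥) (hp : IsMinimalGradedCover 𝒜 ℳ δ p)
    {h : (β → A) →ₗ[A] (β → A)} (hh : IsGradedMap (freeGrading 𝒜 δ) δ h) (hph : p ∘ₗ h = p) :
    Function.Bijective h := by
  refine hh.bijective_of_sub_mem_positiveIdeal hneg fun b => hp.mem_positiveIdeal _ ?_
  rw [LinearMap.mem_ker, map_sub, ← LinearMap.comp_apply, hph, sub_self]

theorem exists_equiv [SetLike.GradedSMul 𝒜 ℳ] (hneg : ∀ j < 0, 𝒜 j = ⊥) (hℳ : iSupIndep ℳ)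
    (hp : IsMinimalGradedCover 𝒜 ℳ δ p) (hq : IsMinimalGradedCover 𝒜 ℳ ε q)
    (hrange : LinearMap.range p = LinearMap.range q) :
    ∃ e : (β → A) ≃ₗ[A] (γ → A),
      IsGradedMap (freeGrading 𝒜 ε) δ (e : (β → A) →ₗ[A] (γ → A)) ∧
        (LinearMap.ker p).map (e : (β → A) →ₗ[A] (γ → A)) = LinearMap.ker q := by
  obtain ⟨f, hf, hqf⟩ := hp.isGradedMap.exists_comp_eq (𝒜 := 𝒜) hℳ hq.isGradedMap hrange.le
  obtain ⟨g, hg, hpg⟩ := hq.isGradedMap.exists_comp_eq (𝒜 := 𝒜) hℳ hp.isGradedMap hrange.ge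
  have hgf : Function.Bijective (g ∘ₗ f) :=
    hp.bijective_of_comp_eq hneg (hg.comp hf) (by rw [← LinearMap.comp_assoc, hpg, hqf])
  have hfg : Function.Bijective (f ∘ₗ g) :=
    hq.bijective_of_comp_eq hneg (hf.comp hg) (by rw [← LinearMap.comp_assoc, hqf, hpg])
  have hf_bij : Function.Bijective f :=
    ⟨.of_comp (f := g) hgf.injective, .of_comp (g := g) hfg.surjective⟩
  refine ⟨LinearEquiv.ofBijective f hf_bij, hf, ?_⟩
  rw [← hqf, LinearMap.ker_comp]
  exact Submodule.map_comap_eq_of_surjective hf_bij.surjective _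

end IsMinimalGradedCover

theorem isMinimalGradedCover_mkQ_comp_proj [SetLike.GradedOne 𝒜] {I : Ideal A}
    (hI : I ≤ positiveIdeal 𝒜) :
    IsMinimalGradedCover 𝒜 (quotientGrading 𝒜 I) (0 : Fin 1 → ℤ) (I.mkQ ∘ₗ LinearMap.proj 0) where
  isGradedMap b := by
    rw [Subsingleton.elim b 0]
    exact ⟨1, SetLike.GradedOne.one_mem (A := 𝒜), by simp⟩
  mem_positiveIdeal x hx b := by
    rw [LinearMap.ker_comp, Submodule.ker_mkQ] at hx
    rw [Subsingleton.elim b 0]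
    exact hI hx

namespace MinimalGradedFreeResolution

variable {M : Type w} [AddCommGroup M] [Module A M] [Module k M] {ℳ : ℤ → Submodule k M}

theorem d_apply_mem_positiveIdeal (F : MinimalGradedFreeResolution 𝒜 ℳ) (i : ℕ)
    (x : Fin (F.rank (i + 1)) → A) (c : Fin (F.rank i)) : F.d i x c ∈ positiveIdeal 𝒜 := by
  rw [linearMap_apply_eq_sum, Finset.sum_apply]
  exact Ideal.sum_mem _ fun b _ => Ideal.mul_mem_left _ _ (F.d_minimal i b c)

theorem isMinimalGradedCover_aug (F : MinimalGradedFreeResolution 𝒜 ℳ) :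
    IsMinimalGradedCover 𝒜 ℳ (F.deg 0) F.aug where
  isGradedMap := F.aug_homogeneous
  mem_positiveIdeal x hx := by
    obtain ⟨y, rfl⟩ := (F.exact_aug x).1 hx
    exact F.d_apply_mem_positiveIdeal 0 y

theorem isMinimalGradedCover_d (F : MinimalGradedFreeResolution 𝒜 ℳ) (i : ℕ) :
    IsMinimalGradedCover 𝒜 (freeGrading 𝒜 (F.deg i)) (F.deg (i + 1)) (F.d i) where
  isGradedMap b := mem_freeGrading.2 (F.d_homogeneous i b)
  mem_positiveIdeal x hx := by
    obtain ⟨y, rfl⟩ := (F.exact_d i x).1 hx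
    exact F.d_apply_mem_positiveIdeal (i + 1) y

variable [GradedAlgebra 𝒜] [Finite γ] {ε : γ → ℤ}

theorem exists_equiv_zero [SetLike.GradedSMul 𝒜 ℳ] (hneg : ∀ j < 0, 𝒜 j = ⊥) (hℳ : iSupIndep ℳ)
    (F : MinimalGradedFreeResolution 𝒜 ℳ) {q : (γ → A) →ₗ[A] M}
    (hq : IsMinimalGradedCover 𝒜 ℳ ε q) (hsurj : Function.Surjective q) :
    ∃ e : (Fin (F.rank 0) → A) ≃ₗ[A] (γ → A),
      IsGradedMap (freeGrading 𝒜 ε) (F.deg 0) (e : (Fin (F.rank 0) → A) →ₗ[A] (γ → A)) ∧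
        (LinearMap.range (F.d 0)).map (e : (Fin (F.rank 0) → A) →ₗ[A] (γ → A)) =
          LinearMap.ker q := by
  rw [← F.exact_aug.linearMap_ker_eq]
  exact F.isMinimalGradedCover_aug.exists_equiv hneg hℳ hq <|
    (LinearMap.range_eq_top.2 F.aug_surjective).trans (LinearMap.range_eq_top.2 hsurj).symm

theorem exists_equiv_succ {κ : Type*} (hneg : ∀ j < 0, 𝒜 j = ⊥)
    (F : MinimalGradedFreeResolution 𝒜 ℳ) {i : ℕ} {δ : κ → ℤ}
    (e : (Fin (F.rank i) → A) ≃ₗ[A] (κ → A))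
    (he : IsGradedMap (freeGrading 𝒜 δ) (F.deg i) (e : (Fin (F.rank i) → A) →ₗ[A] (κ → A)))
    {q : (γ → A) →ₗ[A] (κ → A)} (hq : IsMinimalGradedCover 𝒜 (freeGrading 𝒜 δ) ε q)
    (hrange : (LinearMap.range (F.d i)).map (e : (Fin (F.rank i) → A) →ₗ[A] (κ → A)) =
      LinearMap.range q) :
    ∃ e' : (Fin (F.rank (i + 1)) → A) ≃ₗ[A] (γ → A),
      IsGradedMap (freeGrading 𝒜 ε) (F.deg (i + 1))
          (e' : (Fin (F.rank (i + 1)) → A) →ₗ[A] (γ → A)) ∧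
        (LinearMap.range (F.d (i + 1))).map (e' : (Fin (F.rank (i + 1)) → A) →ₗ[A] (γ → A)) =
          LinearMap.ker q := by
  have hd := F.isMinimalGradedCover_d i
  have hker : LinearMap.ker ((e : (Fin (F.rank i) → A) →ₗ[A] (κ → A)) ∘ₗ F.d i) =
      LinearMap.ker (F.d i) := LinearEquiv.ker_comp e (F.d i)
  rw [← (F.exact_d i).linearMap_ker_eq, ← hker]
  refine IsMinimalGradedCover.exists_equiv hneg (iSupIndep_freeGrading δ)
    ⟨he.comp (𝒜 := 𝒜) hd.isGradedMap, fun x hx => hd.mem_positiveIdeal x (hker.le hx)⟩ hq ?_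
  rw [LinearMap.range_comp, hrange]

theorem exists_equiv [SetLike.GradedSMul 𝒜 ℳ] (hneg : ∀ j < 0, 𝒜 j = ⊥) (hℳ : iSupIndep ℳ)
    (F G : MinimalGradedFreeResolution 𝒜 ℳ) (i : ℕ) :
    ∃ e : (Fin (F.rank i) → A) ≃ₗ[A] (Fin (G.rank i) → A),
      IsGradedMap (freeGrading 𝒜 (G.deg i)) (F.deg i)
          (e : (Fin (F.rank i) → A) →ₗ[A] (Fin (G.rank i) → A)) ∧
        (LinearMap.range (F.d i)).map (e : (Fin (F.rank i) → A) →ₗ[A] (Fin (G.rank i) → A)) =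
          LinearMap.range (G.d i) := by
  induction i with
  | zero =>
    rw [← G.exact_aug.linearMap_ker_eq]
    exact F.exists_equiv_zero hneg hℳ G.isMinimalGradedCover_aug G.aug_surjective
  | succ i ih =>
    obtain ⟨e, he, hrange⟩ := ih
    rw [← (G.exact_d i).linearMap_ker_eq]
    exact F.exists_equiv_succ hneg e he (G.isMinimalGradedCover_d i) hrange

theorem castelnuovoMumfordRegularity_eq_zero [SetLike.GradedSMul 𝒜 ℳ] [Nontrivial A]
    (hneg : ∀ j < 0, 𝒜 j = ⊥) (hℳ : iSupIndep ℳ) (G : MinimalGradedFreeResolution 𝒜 ℳ)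
    (hG : ∀ i b, G.deg i b = i) (hrank : G.rank 0 ≠ 0) : castelnuovoMumfordRegularity 𝒜 ℳ = 0 := by
  refine le_antisymm (sSup_le ?_) (le_sSup ⟨G, 0, ⟨0, hrank.bot_lt⟩, by simp [hG]⟩)
  rintro _ ⟨F, i, b, rfl⟩
  obtain ⟨e, he, -⟩ := exists_equiv hneg hℳ F G i
  obtain ⟨c, hc⟩ := IsGradedMap.exists_degree_eq hneg e he b
  simp [← hc, hG]

end MinimalGradedFreeResolution

theorem exists_deg_le_of_castelnuovoMumfordRegularity_eq_zero {M : Type w} [AddCommGroup M]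
    [Module A M] [Module k M] {ℳ : ℤ → Submodule k M}
    (hreg : castelnuovoMumfordRegularity 𝒜 ℳ = 0) :
    ∃ F : MinimalGradedFreeResolution 𝒜 ℳ, ∀ i b, F.deg i b ≤ i := by
  have hne : Nonempty (MinimalGradedFreeResolution 𝒜 ℳ) := by
    by_contra h
    simp [castelnuovoMumfordRegularity, not_nonempty_iff.1 h] at hreg
  obtain ⟨F⟩ := hne
  refine ⟨F, fun i b => sub_nonpos.1 ?_⟩
  have hle : (((F.deg i b - (i : ℤ) : ℤ) : ℝ) : EReal) ≤ 0 :=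
    hreg ▸ le_sSup (Set.mem_ofPred.2 ⟨F, i, b, rfl⟩)
  exact_mod_cast hle

theorem ker_linearCombination_le_of_castelnuovoMumfordRegularity_eq_zero [GradedAlgebra 𝒜]
    (hneg : ∀ j < 0, 𝒜 j = ⊥) {κ : Type*} [Fintype κ] {y : κ → A} (hy : ∀ c, y c ∈ 𝒜 1)
    (hmin : ∀ x ∈ LinearMap.ker (Fintype.linearCombination A y), ∀ c, x c ∈ positiveIdeal 𝒜)
    (hreg : castelnuovoMumfordRegularity 𝒜 (quotientGrading 𝒜 (Ideal.span (Set.range y))) = 0) :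
    LinearMap.ker (Fintype.linearCombination A y) ≤
      Submodule.span A {x ∈ LinearMap.ker (Fintype.linearCombination A y) |
        ∃ j ≤ 1, ∀ c, x c ∈ 𝒜 j} := by
  classical
  have hY : Set.range y ⊆ 𝒜 1 := Set.range_subset_iff.2 hy
  obtain ⟨F, hF⟩ := exists_deg_le_of_castelnuovoMumfordRegularity_eq_zero hreg
  obtain ⟨e₀, he₀, hrange₀⟩ := F.exists_equiv_zero hneg
    (iSupIndep_quotientGrading 𝒜 (Ideal.homogeneous_span 𝒜 _ fun a ha => ⟨1, hY ha⟩))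
    (isMinimalGradedCover_mkQ_comp_proj (span_le_positiveIdeal 𝒜 hY))
    ((Submodule.mkQ_surjective _).comp fun a => ⟨fun _ => a, rfl⟩)
  let q : (κ → A) →ₗ[A] (Fin 1 → A) := LinearMap.pi fun _ => Fintype.linearCombination A y
  have hker : LinearMap.ker q = LinearMap.ker (Fintype.linearCombination A y) := by
    simp [q, LinearMap.ker_pi]
  have hq : IsMinimalGradedCover 𝒜 (freeGrading 𝒜 0) (1 : κ → ℤ) q :=
    ⟨fun c => (mem_freeGrading (𝒜 := 𝒜)).2 fun _ => by
      simpa [q, Fintype.linearCombination_apply_single] using hy c,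
      fun x hx => hmin x (hker.le hx)⟩
  obtain ⟨e₁, he₁, hrange₁⟩ := F.exists_equiv_succ hneg e₀ he₀ hq <| by
    rw [hrange₀, LinearMap.ker_comp, Submodule.ker_mkQ]
    ext x
    rw [Submodule.mem_comap, ← Ideal.submodule_span_eq, ← Fintype.range_linearCombination]
    exact exists_congr fun a => (funext_iff (f := q a) (g := x)).trans Fin.forall_fin_one |>.symm
  rw [hker] at hrange₁
  intro x hx
  obtain ⟨_, ⟨a, rfl⟩, rfl⟩ := hrange₁.ge hx
  have hgraded := he₁.comp (𝒜 := 𝒜) (F.isMinimalGradedCover_d 1).isGradedMap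
  rw [← LinearMap.comp_apply, linearMap_apply_eq_sum]
  refine sum_mem fun b _ => Submodule.smul_mem _ _ (Submodule.subset_span
    ⟨?_, F.deg 2 b - 1, ?_, mem_freeGrading.1 (hgraded b)⟩)
  · exact hrange₁.le (Submodule.mem_map_of_mem (LinearMap.mem_range_self _ _))
  · have hb : F.deg 2 b ≤ 2 := mod_cast hF 2 b
    omega

theorem colon_le_span_of_castelnuovoMumfordRegularity_eq_zero [GradedAlgebra 𝒜]
    (hneg : ∀ j < 0, 𝒜 j = ⊥) {a b : A} (ha : a ∈ 𝒜 1) (hb : b ∈ 𝒜 1)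
    (hba : (Ideal.span {b}).colon {a} ≤ positiveIdeal 𝒜)
    (hab : (Ideal.span {a}).colon {b} ≤ positiveIdeal 𝒜)
    (hreg : castelnuovoMumfordRegularity 𝒜 (quotientGrading 𝒜 (Ideal.span {a, b})) = 0) :
    (Ideal.span {b}).colon {a} ≤
      Ideal.span {x ∈ (Ideal.span {b}).colon {a} | ∃ j ≤ 1, x ∈ 𝒜 j} := by
  have hker : ∀ x, x ∈ LinearMap.ker (Fintype.linearCombination A ![a, b]) ↔
      x 0 * a + x 1 * b = 0 := fun x => by
    simp [Fintype.linearCombination_apply, Fin.sum_univ_two]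
  have hcol₀ : ∀ x ∈ LinearMap.ker (Fintype.linearCombination A ![a, b]),
      x 0 ∈ (Ideal.span {b}).colon {a} := fun x hx =>
    Submodule.mem_colon_singleton.2 <| Ideal.mem_span_singleton'.2
      ⟨-x 1, (neg_mul _ _).trans (eq_neg_of_add_eq_zero_left ((hker x).1 hx)).symm⟩
  have hcol₁ : ∀ x ∈ LinearMap.ker (Fintype.linearCombination A ![a, b]),
      x 1 ∈ (Ideal.span {a}).colon {b} := fun x hx =>
    Submodule.mem_colon_singleton.2 <| Ideal.mem_span_singleton'.2
      ⟨-x 0, (neg_mul _ _).trans (eq_neg_of_add_eq_zero_right ((hker x).1 hx)).symm⟩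
  rw [← Matrix.range_cons_cons_empty a b ![]] at hreg
  have hle := ker_linearCombination_le_of_castelnuovoMumfordRegularity_eq_zero hneg
    (Fin.forall_fin_two.2 ⟨ha, hb⟩)
    (fun x hx => Fin.forall_fin_two.2 ⟨hba (hcol₀ x hx), hab (hcol₁ x hx)⟩) hreg
  intro x hx
  obtain ⟨c, hc⟩ := Ideal.mem_span_singleton'.1 (Submodule.mem_colon_singleton.1 hx)
  have hx : ![x, -c] ∈ LinearMap.ker (Fintype.linearCombination A ![a, b]) :=
    (hker _).2 (by simp [hc])
  suffices h : Submodule.span A {x ∈ LinearMap.ker (Fintype.linearCombination A ![a, b]) |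
      ∃ j ≤ 1, ∀ c, x c ∈ 𝒜 j} ≤ Submodule.comap (LinearMap.proj 0)
        (Ideal.span {x ∈ (Ideal.span {b}).colon {a} | ∃ j ≤ 1, x ∈ 𝒜 j}) from h (hle hx)
  refine Submodule.span_le.2 ?_
  rintro x ⟨hx, j, hj, hxj⟩
  exact Ideal.subset_span ⟨hcol₀ x hx, j, hj, hxj 0⟩

end GradedCovers

section LinearQuotients

variable {k : Type u} {A : Type v} [CommRing k] [CommRing A] [Algebra k A]
  (𝒜 : ℤ → Submodule k A)

/-- Submodules of `A ^ γ` that are obtained from `0` by successively adding vectors with linear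
entries, in such a way that all the colon ideals that occur are generated by subsets of `V`. The
point of the notion is that it is inherited by syzygy modules. -/
inductive HasLinearQuotients (V : Set A) {γ : Type*} : Submodule A (γ → A) → Prop
  | bot : HasLinearQuotients V ⊥
  | sup_span {N : Submodule A (γ → A)} {z : γ → A} {Y : Set A} :
      HasLinearQuotients V N → (∀ c, z c ∈ 𝒜 1) → Y ⊆ V → N.colon {z} = Ideal.span Y →
      HasLinearQuotients V (N ⊔ Submodule.span A {z})

/-- Colon ideals `(Y) : y` with `Y ⊆ V` and `y ∈ V`, `y ∉ Y`, are generated by subsets of `V`: the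
ring is strongly Koszul with respect to the generators `V`. -/
def HasLinearColonIdeals (V : Set A) : Prop :=
  ∀ Y ⊆ V, ∀ y ∈ V, y ∉ Y → ∃ Y' ⊆ V, (Ideal.span Y).colon {y} = Ideal.span Y'

variable {𝒜} {V : Set A} {γ γ' : Type*}

theorem inf_comap_sup_span_singleton {M : Type*} [AddCommGroup M] [Module A M]
    {K : Submodule A M} {x : M} (hx : x ∈ K) (π : M →ₗ[A] A) (I : Ideal A) :
    K ⊓ Submodule.comap π (I ⊔ Ideal.span {π x}) =
      K ⊓ Submodule.comap π I ⊔ Submodule.span A {x} := by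
  have hspan : Submodule.map π (Submodule.span A {x}) = Ideal.span {π x} := by
    rw [Submodule.map_span, Set.image_singleton, Ideal.submodule_span_eq]
  refine le_antisymm ?_ (le_inf (sup_le inf_le_left ?_) (sup_le ?_ ?_))
  · rintro v ⟨hvK, hv⟩
    obtain ⟨s, hs, t, ht, hst⟩ := Submodule.mem_sup.1 hv
    obtain ⟨a, rfl⟩ := Ideal.mem_span_singleton'.1 ht
    refine Submodule.mem_sup.2 ⟨v - a • x, ⟨K.sub_mem hvK (K.smul_mem a hx), ?_⟩, a • x,
      Submodule.smul_mem _ _ (Submodule.mem_span_singleton_self x), sub_add_cancel v _⟩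
    rw [SetLike.mem_coe, Submodule.mem_comap, map_sub, ← hst, map_smul, smul_eq_mul,
      add_sub_cancel_right]
    exact hs
  · exact (Submodule.span_singleton_le_iff_mem _ _).2 hx
  · exact inf_le_right.trans (Submodule.comap_mono le_sup_left)
  · exact Submodule.map_le_iff_le_comap.1 (hspan.le.trans le_sup_right)

theorem linearCombination_cons {m : ℕ} (x : γ → A) (z : Fin m → γ → A) (v : Fin (m + 1) → A) :
    Fintype.linearCombination A (Fin.cons x z : Fin (m + 1) → γ → A) v =
      v 0 • x + Fintype.linearCombination A z (Fin.tail v) := by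
  simp [Fintype.linearCombination_apply, Fin.sum_univ_succ, Fin.tail]

theorem ker_linearCombination_cons_inf_ker_proj {m : ℕ} (x : γ → A) (z : Fin m → γ → A) :
    LinearMap.ker (Fintype.linearCombination A (Fin.cons x z : Fin (m + 1) → γ → A)) ⊓
        LinearMap.ker (LinearMap.proj 0) =
      (LinearMap.ker (Fintype.linearCombination A z)).map (LinearMap.vecCons 0 LinearMap.id) := by
  ext v
  simp only [Submodule.mem_inf, Submodule.mem_map, LinearMap.mem_ker, LinearMap.proj_apply,
    linearCombination_cons]
  constructor
  · rintro ⟨hv, hv0⟩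
    rw [hv0, zero_smul, zero_add] at hv
    refine ⟨Fin.tail v, hv, ?_⟩
    conv_rhs => rw [← Fin.cons_self_tail v, hv0]
    rfl
  · rintro ⟨u, hu, rfl⟩
    exact ⟨(congrArg₂ (· + ·) (zero_smul A x) hu).trans (add_zero 0), rfl⟩

theorem map_proj_ker_linearCombination_cons_le {m : ℕ} (x : γ → A) (z : Fin m → γ → A) :
    (LinearMap.ker (Fintype.linearCombination A (Fin.cons x z : Fin (m + 1) → γ → A))).map
        (LinearMap.proj 0) ≤ (Submodule.span A (Set.range z)).colon {x} := by
  rintro _ ⟨v, hv, rfl⟩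
  rw [SetLike.mem_coe, LinearMap.mem_ker, linearCombination_cons] at hv
  rw [Submodule.mem_colon_singleton, LinearMap.proj_apply, eq_neg_of_add_eq_zero_left hv,
    ← Fintype.range_linearCombination]
  exact Submodule.neg_mem _ ⟨_, rfl⟩

theorem exists_linear_relation [GradedAlgebra 𝒜] {m : ℕ} {x : γ → A} {z : Fin m → γ → A}
    (hx : ∀ c, x c ∈ 𝒜 1) (hz : ∀ j c, z j c ∈ 𝒜 1) {y : A} (hy : y ∈ 𝒜 1)
    (hyx : y ∈ (Submodule.span A (Set.range z)).colon {x}) :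
    ∃ v ∈ LinearMap.ker (Fintype.linearCombination A (Fin.cons x z : Fin (m + 1) → γ → A)),
      (∀ j, v j ∈ 𝒜 1) ∧ v 0 = y := by
  have hgraded : IsGradedMap (freeGrading 𝒜 (0 : γ → ℤ)) (1 : Fin m → ℤ)
      (Fintype.linearCombination A z) := fun j => mem_freeGrading.2 fun c => by
    simpa [Fintype.linearCombination_apply_single] using hz j c
  have hyx₂ : y • x ∈ freeGrading 𝒜 (0 : γ → ℤ) 2 := mem_freeGrading.2 fun c =>
    SetLike.mul_mem_graded (A := 𝒜) (i := 1) (j := 1) hy (hx c)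
  rw [Submodule.mem_colon_singleton, ← Fintype.range_linearCombination] at hyx
  obtain ⟨a, ha, hax⟩ := hgraded.exists_mem_freeGrading_of_mem_range (𝒜 := 𝒜)
    (iSupIndep_freeGrading 0) hyx₂ hyx
  refine ⟨Fin.cons y (-a), ?_, Fin.cases hy fun j => ?_, rfl⟩
  · simp [LinearMap.mem_ker, linearCombination_cons, hax]
  · simpa using mem_freeGrading.1 ha j

namespace HasLinearQuotients

theorem map {N : Submodule A (γ → A)} (hN : HasLinearQuotients 𝒜 V N)
    (f : (γ → A) →ₗ[A] (γ' → A)) (hf : Function.Injective f)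
    (hf_linear : ∀ x, (∀ b, x b ∈ 𝒜 1) → ∀ c, f x c ∈ 𝒜 1) :
    HasLinearQuotients 𝒜 V (N.map f) := by
  induction hN with
  | bot => rw [Submodule.map_bot]; exact .bot
  | sup_span hN hz hY hcolon ih =>
    rw [Submodule.map_sup, Submodule.map_span, Set.image_singleton]
    refine .sup_span ih (hf_linear _ hz) hY (hcolon ▸ Ideal.ext fun a => ?_)
    simp only [Submodule.mem_colon_singleton, ← map_smul, Submodule.mem_map, hf.eq_iff,
      exists_eq_right]

/-- Going up from `ker π`, the coordinates in `Z` are adjoined one at a time; the colon ideals that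
occur are those of the ideals of coordinates. -/
theorem inf_comap_span (hcolon : HasLinearColonIdeals V) {K : Submodule A (γ → A)}
    {π : (γ → A) →ₗ[A] A} (hker : HasLinearQuotients 𝒜 V (K ⊓ LinearMap.ker π)) {Z : Set A}
    (hfin : Z.Finite) (hZ : Z ⊆ V) (hlift : ∀ y ∈ Z, ∃ x ∈ K, (∀ c, x c ∈ 𝒜 1) ∧ π x = y) :
    HasLinearQuotients 𝒜 V (K ⊓ Submodule.comap π (Ideal.span Z)) := by
  induction Z, hfin using Set.Finite.induction_on with
  | empty => rwa [Ideal.span_empty, Submodule.comap_bot]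
  | @insert y Z hyZ _ ih =>
    obtain ⟨hy, hZV⟩ := Set.insert_subset_iff.1 hZ
    obtain ⟨x, hxK, hx, rfl⟩ := hlift y (Set.mem_insert _ _)
    obtain ⟨Y, hY, hcol⟩ := hcolon Z hZV _ hy hyZ
    rw [Ideal.span_insert, sup_comm, inf_comap_sup_span_singleton hxK]
    refine .sup_span (ih hZV fun y' hy' => hlift y' (Set.mem_insert_of_mem _ hy')) hx hY
      (hcol ▸ Ideal.ext fun a => ?_)
    simp [Submodule.mem_colon_singleton, K.smul_mem a hxK]

theorem of_inf_ker (hV : V.Finite) (hcolon : HasLinearColonIdeals V) {K : Submodule A (γ → A)}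
    {π : (γ → A) →ₗ[A] A} (hker : HasLinearQuotients 𝒜 V (K ⊓ LinearMap.ker π)) {Y : Set A}
    (hY : Y ⊆ V) (hlift : ∀ y ∈ Y, ∃ x ∈ K, (∀ c, x c ∈ 𝒜 1) ∧ π x = y)
    (hmap : K.map π ≤ Ideal.span Y) : HasLinearQuotients 𝒜 V K := by
  rw [← inf_eq_left.2 (Submodule.map_le_iff_le_comap.1 hmap)]
  exact hker.inf_comap_span hcolon (hV.subset hY) hY hlift

theorem comap_proj (hV : V.Finite) (hV1 : V ⊆ 𝒜 1) (hcolon : HasLinearColonIdeals V) {Y : Set A}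
    (hY : Y ⊆ V) :
    HasLinearQuotients 𝒜 V
      (Submodule.comap (LinearMap.proj (R := A) (φ := fun _ : Fin 1 => A) 0) (Ideal.span Y)) := by
  have hker : LinearMap.ker (LinearMap.proj (R := A) (φ := fun _ : Fin 1 => A) 0) = ⊥ :=
    LinearMap.ker_eq_bot.2 fun x y h => funext (Fin.forall_fin_one.2 h)
  refine of_inf_ker hV hcolon (π := LinearMap.proj 0) ?_ hY (fun y hy => ?_)
    (Submodule.map_comap_le _ _)
  · rw [hker, inf_bot_eq]
    exact .bot
  · exact ⟨fun _ => y, Ideal.subset_span hy, fun _ => hV1 (hY hy), rfl⟩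

variable [GradedAlgebra 𝒜]

theorem ker_linearCombination_cons (hV : V.Finite) (hV1 : V ⊆ 𝒜 1)
    (hcolon : HasLinearColonIdeals V) {m : ℕ} {x : γ → A} {z : Fin m → γ → A}
    (hx : ∀ c, x c ∈ 𝒜 1) (hz : ∀ j c, z j c ∈ 𝒜 1) {Y : Set A} (hY : Y ⊆ V)
    (hYx : (Submodule.span A (Set.range z)).colon {x} = Ideal.span Y)
    (hker : HasLinearQuotients 𝒜 V (LinearMap.ker (Fintype.linearCombination A z))) :
    HasLinearQuotients 𝒜 V
      (LinearMap.ker (Fintype.linearCombination A (Fin.cons x z : Fin (m + 1) → γ → A))) := by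
  refine of_inf_ker hV hcolon (π := LinearMap.proj 0) ?_ hY (fun y hy => ?_)
    ((map_proj_ker_linearCombination_cons_le x z).trans hYx.le)
  · rw [ker_linearCombination_cons_inf_ker_proj]
    exact hker.map _ (Fin.cons_right_injective (α := fun _ => A) 0)
      fun v hv => Fin.cases (zero_mem _) hv
  · exact exists_linear_relation hx hz (hV1 (hY hy)) (hYx.ge (Ideal.subset_span hy))

theorem exists_linear_generators (hV : V.Finite) (hV1 : V ⊆ 𝒜 1) (hcolon : HasLinearColonIdeals V)
    {N : Submodule A (γ → A)} (hN : HasLinearQuotients 𝒜 V N) :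
    ∃ (m : ℕ) (z : Fin m → γ → A), (∀ j c, z j c ∈ 𝒜 1) ∧
      LinearMap.range (Fintype.linearCombination A z) = N ∧
      HasLinearQuotients 𝒜 V (LinearMap.ker (Fintype.linearCombination A z)) := by
  simp only [Fintype.range_linearCombination]
  induction hN with
  | bot =>
    refine ⟨0, Fin.elim0, fun j => j.elim0, by simp, ?_⟩
    rw [Subsingleton.elim (LinearMap.ker _) ⊥]
    exact .bot
  | @sup_span N x Y _ hx hY hYx ih =>
    obtain ⟨m, z, hz, rfl, hker⟩ := ih
    refine ⟨m + 1, Fin.cons x z, Fin.cases hx hz, ?_,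
      ker_linearCombination_cons hV hV1 hcolon hx hz hY hYx hker⟩
    rw [Fin.range_cons, Submodule.span_insert, sup_comm]

end HasLinearQuotients

theorem exists_linear_minimalGradedFreeResolution [GradedAlgebra 𝒜] (hV : V.Finite)
    (hV1 : V ⊆ 𝒜 1) (hcolon : HasLinearColonIdeals V) {Y : Set A} (hY : Y ⊆ V) :
    ∃ F : MinimalGradedFreeResolution 𝒜 (quotientGrading 𝒜 (Ideal.span Y)),
      (∀ i b, F.deg i b = i) ∧ F.rank 0 = 1 := by
  let S := (r : ℕ) × {N : Submodule A (Fin r → A) // HasLinearQuotients 𝒜 V N}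
  choose m z hz hrange hker using fun s : S => s.2.2.exists_linear_generators hV hV1 hcolon
  let s : ℕ → S := fun i => Nat.rec ⟨1, _, .comap_proj hV hV1 hcolon hY⟩
    (fun _ s => ⟨m s, _, hker s⟩) i
  have hsingle : ∀ i b c, Fintype.linearCombination A (z (s i)) (Pi.single b 1) c ∈ 𝒜 1 :=
    fun i b => by simpa [Fintype.linearCombination_apply_single] using hz (s i) b
  have haug := isMinimalGradedCover_mkQ_comp_proj (span_le_positiveIdeal 𝒜 (hY.trans hV1))
  refine ⟨{
    rank := fun i => (s i).1
    deg := fun i _ => i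
    aug := (Ideal.span Y).mkQ ∘ₗ LinearMap.proj 0
    d := fun i => Fintype.linearCombination A (z (s i))
    aug_surjective := (Submodule.mkQ_surjective _).comp fun a => ⟨fun _ => a, rfl⟩
    exact_aug := LinearMap.exact_iff.2 ?_
    exact_d := fun i => LinearMap.exact_iff.2 (hrange (s (i + 1))).symm
    aug_homogeneous := haug.isGradedMap
    d_homogeneous := fun i b c => by simpa using hsingle i b c
    d_minimal := fun i b c => mem_positiveIdeal_of_mem one_pos (hsingle i b c) },
    fun _ _ => rfl, rfl⟩
  rw [hrange, LinearMap.ker_comp, Submodule.ker_mkQ]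
  rfl

theorem castelnuovoMumfordRegularity_quotient_span_eq_zero [GradedAlgebra 𝒜] [Nontrivial A]
    (hneg : ∀ j < 0, 𝒜 j = ⊥) (hV : V.Finite) (hV1 : V ⊆ 𝒜 1) (hcolon : HasLinearColonIdeals V)
    {Y : Set A} (hY : Y ⊆ V) :
    castelnuovoMumfordRegularity 𝒜 (quotientGrading 𝒜 (Ideal.span Y)) = 0 := by
  obtain ⟨F, hdeg, hrank⟩ := exists_linear_minimalGradedFreeResolution hV hV1 hcolon hY
  exact F.castelnuovoMumfordRegularity_eq_zero hneg
    (iSupIndep_quotientGrading 𝒜 (Ideal.homogeneous_span 𝒜 _ fun a ha => ⟨1, hV1 (hY ha)⟩)) hdeg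
    (by simp [hrank])

end LinearQuotients

section ScrollMonoid

variable {t : ℕ} {n : Fin t → ℕ}

/-- The sum of the positions of the variables in a monomial. -/
def scrollWeight (s : Multiset (ScrollVar n)) : ℕ := (s.map fun v => (v.2 : ℕ)).sum

theorem scrollWeight_cons (v : ScrollVar n) (s : Multiset (ScrollVar n)) :
    scrollWeight (v ::ₘ s) = v.2 + scrollWeight s := by
  simp [scrollWeight]

/-- Families that annihilate the `2`-minors of the scroll matrix. -/
def IsScrollFamily {B : Type*} [CommMonoid B] (f : ScrollVar n → B) : Prop :=
  ∀ (i j : Fin t) (p : Fin (n i)) (q : Fin (n j)),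
    f ⟨i, p.castSucc⟩ * f ⟨j, q.succ⟩ = f ⟨j, q.castSucc⟩ * f ⟨i, p.succ⟩

namespace IsScrollFamily

variable {B : Type*} [CommMonoid B] {f : ScrollVar n → B}

theorem exists_raise (hf : IsScrollFamily f) {i : Fin t} (p : Fin (n i))
    {s : Multiset (ScrollVar n)} (hs : scrollWeight s ≠ 0) :
    ∃ s', f ⟨i, p.castSucc⟩ * (s.map f).prod = f ⟨i, p.succ⟩ * (s'.map f).prod ∧
      s'.map Sigma.fst = s.map Sigma.fst ∧ scrollWeight s' + 1 = scrollWeight s := by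
  obtain ⟨⟨j, r'⟩, hmem, hr⟩ : ∃ w ∈ s, (w.2 : ℕ) ≠ 0 := by
    by_contra! h
    exact hs (Multiset.sum_eq_zero (Multiset.forall_mem_map_iff.2 h))
  obtain ⟨s, rfl⟩ := Multiset.exists_cons_of_mem hmem
  obtain ⟨r, rfl⟩ : ∃ r : Fin (n j), r.succ = r' := Fin.exists_succ_eq.2 (Fin.val_ne_zero_iff.1 hr)
  refine ⟨⟨j, r.castSucc⟩ ::ₘ s, ?_, by simp only [Multiset.map_cons], ?_⟩
  · rw [Multiset.map_cons, Multiset.map_cons, Multiset.prod_cons, Multiset.prod_cons, ← mul_assoc,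
      hf, ← mul_assoc, mul_comm (f ⟨j, _⟩)]
  · rw [scrollWeight_cons, scrollWeight_cons, Fin.val_castSucc, Fin.val_succ]
    ring

theorem exists_raise_of_le (hf : IsScrollFamily f) {i : Fin t} {p q : Fin (n i + 1)} (hpq : p ≤ q)
    {s : Multiset (ScrollVar n)} (hs : (q : ℕ) ≤ p + scrollWeight s) :
    ∃ s', f ⟨i, p⟩ * (s.map f).prod = f ⟨i, q⟩ * (s'.map f).prod ∧
      s'.map Sigma.fst = s.map Sigma.fst ∧ q + scrollWeight s' = p + scrollWeight s := by
  induction q using Fin.induction with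
  | zero =>
    obtain rfl := Fin.le_zero_iff.1 hpq
    exact ⟨s, rfl, rfl, rfl⟩
  | succ q ih =>
    rw [Fin.val_succ] at hs
    obtain rfl | hlt := hpq.eq_or_lt
    · exact ⟨s, rfl, rfl, rfl⟩
    obtain ⟨s₁, hprod₁, hfst₁, hwt₁⟩ := ih (Fin.le_castSucc_iff.2 hlt) (Nat.le_of_succ_le hs)
    rw [Fin.val_castSucc] at hwt₁
    obtain ⟨s₂, hprod₂, hfst₂, hwt₂⟩ := hf.exists_raise q (s := s₁) (by omega)
    exact ⟨s₂, hprod₁.trans hprod₂, hfst₂.trans hfst₁, by rw [Fin.val_succ]; omega⟩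

theorem prod_map_eq_prod_map (hf : IsScrollFamily f) {s s' : Multiset (ScrollVar n)}
    (hfst : s.map Sigma.fst = s'.map Sigma.fst) (hwt : scrollWeight s = scrollWeight s') :
    (s.map f).prod = (s'.map f).prod := by
  induction hm : s.card generalizing s s' with
  | zero =>
    rw [Multiset.card_eq_zero] at hm
    subst hm
    rw [Multiset.map_zero, eq_comm, Multiset.map_eq_zero] at hfst
    rw [hfst]
  | succ m ih =>
    obtain ⟨⟨i, p⟩, hp⟩ := Multiset.card_pos_iff_exists_mem.1 (by omega : 0 < s.card)
    obtain ⟨⟨j, q⟩, hq, hij⟩ := Multiset.mem_map.1 (hfst ▸ Multiset.mem_map_of_mem Sigma.fst hp)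
    obtain rfl : j = i := hij
    obtain ⟨s, rfl⟩ := Multiset.exists_cons_of_mem hp
    obtain ⟨s', rfl⟩ := Multiset.exists_cons_of_mem hq
    wlog hpq : p ≤ q generalizing p q s s'
    · refine (this p q s' ?_ hq s hp hfst.symm hwt.symm (le_of_not_ge hpq)).symm
      rw [← hm, ← Multiset.card_map Sigma.fst, ← hfst, Multiset.card_map]
    simp only [Multiset.map_cons, Multiset.cons_inj_right, scrollWeight_cons] at hfst hwt
    obtain ⟨s₁, hprod, hfst₁, hwt₁⟩ := hf.exists_raise_of_le hpq (s := s) (by omega)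
    have hcard : s₁.card = m := by
      rw [← Multiset.card_map Sigma.fst, hfst₁, Multiset.card_map]
      simpa using hm
    rw [Multiset.map_cons, Multiset.prod_cons, hprod, Multiset.map_cons, Multiset.prod_cons,
      ih (hfst₁.trans hfst) (by omega) hcard]

end IsScrollFamily

variable (n) in
/-- The monoid of multidegrees of the monomials of the scroll of type `n`: the multiset of the
blocks of the variables together with the sum of their positions. -/
def scrollMonoid : AddSubmonoid (Multiset (Fin t) × ℕ) where
  carrier := {x | x.2 ≤ (x.1.map n).sum}
  zero_mem' := by simp
  add_mem' {x y} hx hy := by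
    simp only [Set.mem_ofPred_eq] at hx hy
    simpa using add_le_add hx hy

theorem mem_scrollMonoid {x : Multiset (Fin t) × ℕ} :
    x ∈ scrollMonoid n ↔ x.2 ≤ (x.1.map n).sum := Iff.rfl

/-- The multidegree of a variable. -/
def scrollPoint (v : ScrollVar n) : scrollMonoid n :=
  ⟨({v.1}, v.2), by simpa [mem_scrollMonoid] using v.2.is_le⟩

theorem scrollPoint_injective : Function.Injective (scrollPoint (n := n)) := by
  rintro ⟨i, p⟩ ⟨j, q⟩ h
  simp only [scrollPoint, Subtype.mk.injEq, Prod.mk.injEq, Multiset.singleton_inj] at h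
  obtain ⟨rfl, h⟩ := h
  rw [Fin.ext h]

theorem coe_sum_map_scrollPoint (s : Multiset (ScrollVar n)) :
    ((s.map scrollPoint).sum : Multiset (Fin t) × ℕ) = (s.map Sigma.fst, scrollWeight s) := by
  induction s using Multiset.induction_on with
  | empty => rfl
  | cons v s ih => simp [ih, scrollPoint, scrollWeight_cons]

theorem sum_map_scrollPoint_surjective :
    Function.Surjective fun s : Multiset (ScrollVar n) => (s.map scrollPoint).sum := by
  rintro ⟨⟨α, a⟩, ha⟩
  suffices h : ∃ s : Multiset (ScrollVar n), s.map Sigma.fst = α ∧ scrollWeight s = a by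
    obtain ⟨s, rfl, rfl⟩ := h
    exact ⟨s, Subtype.ext (coe_sum_map_scrollPoint s)⟩
  rw [mem_scrollMonoid] at ha
  induction α using Multiset.induction_on generalizing a with
  | empty => exact ⟨0, rfl, (Nat.le_zero.1 ha).symm⟩
  | cons i α ih =>
    simp only [Multiset.map_cons, Multiset.sum_cons] at ha
    obtain ⟨s, hfst, hwt⟩ := ih (a - min a (n i)) (by dsimp only; omega)
    refine ⟨⟨i, ⟨min a (n i), by omega⟩⟩ ::ₘ s, by simp [hfst], ?_⟩
    rw [scrollWeight_cons, hwt]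
    exact Nat.add_sub_of_le (min_le_left _ _)

theorem exists_eq_add_scrollPoint_iff {x : scrollMonoid n} {i : Fin t} {α : Multiset (Fin t)}
    (hx : x.1.1 = i ::ₘ α) (p : Fin (n i + 1)) :
    (∃ d, x = d + scrollPoint ⟨i, p⟩) ↔ p ≤ x.1.2 ∧ x.1.2 ≤ p + (α.map n).sum := by
  constructor
  · rintro ⟨d, rfl⟩
    have hd : d.1.1 = α :=
      (Multiset.cons_inj_right i).1 <| ((Multiset.singleton_add i _).symm.trans
        (add_comm _ _)).trans hx
    exact ⟨Nat.le_add_left _ _,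
      (Nat.add_comm _ _).trans_le (Nat.add_le_add_left (hd ▸ mem_scrollMonoid.1 d.2) _)⟩
  · rintro ⟨hp, hle⟩
    refine ⟨⟨(α, x.1.2 - p), mem_scrollMonoid.2 (Nat.sub_le_iff_le_add'.2 hle)⟩,
      Subtype.ext (Prod.ext ?_ (Nat.sub_add_cancel hp).symm)⟩
    exact hx.trans ((Multiset.singleton_add i α).symm.trans (add_comm _ _))

variable (n) in
/-- The degree of a monomial. -/
def scrollDegree : scrollMonoid n →+ ℤ :=
  ((Nat.castAddMonoidHom ℤ).comp (Multiset.cardHom.comp (AddMonoidHom.fst _ _))).comp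
    (scrollMonoid n).subtype

theorem scrollDegree_apply (x : scrollMonoid n) : scrollDegree n x = (x.1.1.card : ℤ) := rfl

theorem scrollDegree_scrollPoint (v : ScrollVar n) : scrollDegree n (scrollPoint v) = 1 := rfl

theorem scrollDegree_sum_map_scrollPoint (s : Multiset (ScrollVar n)) :
    scrollDegree n (s.map scrollPoint).sum = s.card := by
  rw [scrollDegree_apply, coe_sum_map_scrollPoint, Multiset.card_map]

theorem scrollDegree_eq_zero_iff {x : scrollMonoid n} : scrollDegree n x = 0 ↔ x = 0 := by
  refine ⟨fun hx => ?_, fun hx => hx ▸ map_zero _⟩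
  obtain ⟨⟨α, a⟩, ha⟩ := x
  obtain rfl : α = 0 := by simpa [scrollDegree_apply] using hx
  obtain rfl : a = 0 := Nat.le_zero.1 ha
  rfl

theorem ne_zero_of_add_scrollPoint_eq {v w : ScrollVar n} (hvw : v ≠ w) {x d : scrollMonoid n}
    (h : x + scrollPoint w = d + scrollPoint v) : x ≠ 0 := by
  rintro rfl
  have hd : scrollDegree n d = 0 := by
    simpa [scrollDegree_scrollPoint] using congrArg (scrollDegree n) h
  rw [scrollDegree_eq_zero_iff.1 hd, zero_add, zero_add] at h
  exact hvw (scrollPoint_injective h).symm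

theorem exists_mem_of_add_scrollPoint_eq {v w : ScrollVar n} (hvw : v ≠ w) {x d : scrollMonoid n}
    (h : x + scrollPoint w = d + scrollPoint v) : ∃ l ∈ x.1.1, v.1 = l ∨ v.1 = w.1 := by
  by_cases hvw₁ : v.1 = w.1
  · have hx : x.1.1 ≠ 0 := by
      simpa [← scrollDegree_eq_zero_iff, scrollDegree_apply] using
        ne_zero_of_add_scrollPoint_eq hvw h
    exact (Multiset.exists_mem_of_ne_zero hx).imp fun l hl => ⟨hl, .inr hvw₁⟩
  · have hfst : x.1.1 + {w.1} = d.1.1 + {v.1} := congrArg (fun z => z.1.1) h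
    have hv : v.1 ∈ x.1.1 + {w.1} :=
      hfst ▸ Multiset.mem_add.2 (.inr (Multiset.mem_singleton_self _))
    exact ⟨v.1, (Multiset.mem_add.1 hv).resolve_right (by simpa using hvw₁), .inl rfl⟩

theorem exists_scrollPoint_of_add_scrollPoint_eq (hn : ∀ i j, n i = n j) {v w : ScrollVar n}
    (hvw : v ≠ w) {x d : scrollMonoid n} (h : x + scrollPoint w = d + scrollPoint v) :
    ∃ u : ScrollVar n, (∃ x', x = x' + scrollPoint u) ∧
      ∃ d', scrollPoint u + scrollPoint w = d' + scrollPoint v := by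
  have hsum : ∀ α : Multiset (Fin t), (α.map n).sum = α.card * n v.1 := fun α => by
    rw [Multiset.map_congr rfl fun l _ => hn l v.1, Multiset.map_const', Multiset.sum_replicate,
      smul_eq_mul]
  obtain ⟨l, hl, hlv⟩ := exists_mem_of_add_scrollPoint_eq hvw h
  obtain ⟨α, hα⟩ := Multiset.exists_cons_of_mem hl
  obtain ⟨m, hm⟩ : ∃ m : Fin t, ({l} + {w.1} : Multiset (Fin t)) = v.1 ::ₘ {m} := by
    rcases hlv with rfl | hw
    · exact ⟨w.1, rfl⟩
    · exact ⟨l, hw ▸ add_comm _ _⟩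
  have hfst : (x + scrollPoint w).1.1 = v.1 ::ₘ d.1.1 :=
    (congrArg (fun z => z.1.1) h).trans ((add_comm _ _).trans (Multiset.singleton_add _ _))
  have hcard : d.1.1.card = α.card + 1 := by
    simpa [scrollPoint, hα] using (congrArg Multiset.card hfst).symm
  have hxw : (v.2 : ℕ) ≤ x.1.2 + w.2 ∧ x.1.2 + w.2 ≤ v.2 + (d.1.1.map n).sum :=
    (exists_eq_add_scrollPoint_iff hfst v.2).1 ⟨d, h⟩
  have hx : x.1.2 ≤ (x.1.1.map n).sum := x.2
  rw [hsum, hcard, add_one_mul] at hxw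
  rw [hsum, hα, Multiset.card_cons, add_one_mul] at hx
  have hw : (w.2 : ℕ) ≤ n v.1 := (hn w.1 v.1) ▸ w.2.is_le
  refine ⟨⟨l, ⟨max (v.2 - w.2) (x.1.2 - α.card * n v.1), by rw [hn l v.1]; omega⟩⟩,
    (exists_eq_add_scrollPoint_iff hα _).2 ?_, (exists_eq_add_scrollPoint_iff hm v.2).2 ?_⟩
  · rw [hsum]
    dsimp only
    omega
  · simp only [scrollPoint, AddMemClass.mk_add_mk, Prod.mk_add_mk, hsum, Multiset.card_singleton]
    omega

theorem exists_nsmul_scrollPoint_last_add_eq {i l : Fin t} (hl : 1 ≤ n l) :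
    ∃ d, n i • scrollPoint (n := n) ⟨l, Fin.last (n l)⟩ + scrollPoint ⟨i, 0⟩ =
      d + scrollPoint ⟨i, Fin.last (n i)⟩ := by
  have hfst : (n i • scrollPoint (n := n) ⟨l, Fin.last (n l)⟩ + scrollPoint ⟨i, 0⟩).1.1 =
      i ::ₘ n i • {l} := (add_comm _ _).trans (Multiset.singleton_add _ _)
  refine (exists_eq_add_scrollPoint_iff hfst _).2 ?_
  simp only [Fin.val_last, scrollPoint, AddSubmonoidClass.mk_nsmul, Prod.smul_mk, smul_eq_mul,
    Fin.coe_ofNat_eq_mod, Nat.zero_mod, AddSubmonoid.mk_add_mk, Prod.mk_add_mk, add_zero,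
    Multiset.map_nsmul, Multiset.map_singleton, Multiset.sum_nsmul, Multiset.sum_singleton,
    le_add_iff_nonneg_left, zero_le, and_true]
  exact Nat.le_mul_of_pos_right _ hl

theorem le_of_nsmul_scrollPoint_eq_add {i l : Fin t} {m : ℕ} {p : Fin (n l + 1)}
    {x x' d : scrollMonoid n} (hx : scrollDegree n x ≤ 1)
    (hxd : x + scrollPoint ⟨i, 0⟩ = d + scrollPoint ⟨i, Fin.last (n i)⟩)
    (hxx' : m • scrollPoint ⟨l, p⟩ = x' + x) : n i ≤ n l := by
  have hcard : x.1.1.card ≤ 1 := by rwa [scrollDegree_apply, Nat.cast_le_one] at hx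
  have hfst : m • {l} = x'.1.1 + x.1.1 := congrArg (fun z => z.1.1) hxx'
  have hblock : ∀ j ∈ x.1.1, j = l := fun j hj => Multiset.mem_singleton.1 <|
    Multiset.mem_of_mem_nsmul <| hfst ▸ Multiset.mem_add.2 (.inr hj)
  calc
    n i ≤ d.1.2 + n i := Nat.le_add_left _ _
    _ = x.1.2 := (congrArg (fun z => z.1.2) hxd).symm
    _ ≤ (x.1.1.map n).sum := x.2
    _ = x.1.1.card * n l := by
      rw [Multiset.map_congr rfl fun j hj => congrArg n (hblock j hj), Multiset.map_const',
        Multiset.sum_replicate, smul_eq_mul]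
    _ ≤ n l := mul_le_of_le_one_left (Nat.zero_le _) hcard

end ScrollMonoid

section ScrollAlgebra

variable {k : Type u} [CommRing k] {t : ℕ} {n : Fin t → ℕ}

variable (k) in
/-- The natural coordinate of the scroll with a given index. -/
def scrollCoordinate (v : ScrollVar n) : Scroll k n := Ideal.Quotient.mk _ (MvPolynomial.X v)

theorem isScrollFamily_scrollCoordinate : IsScrollFamily (n := n) (scrollCoordinate k) := by
  intro i j p q
  simp only [scrollCoordinate, ← map_mul]
  rw [Ideal.Quotient.eq]
  refine Ideal.subset_span ⟨⟨i, p⟩, ⟨j, q⟩, ?_⟩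
  simp [Matrix.det_fin_two, scrollMatrix]

theorem scrollPoint_castSucc_add_scrollPoint_succ (i j : Fin t) (p : Fin (n i)) (q : Fin (n j)) :
    scrollPoint (n := n) ⟨i, p.castSucc⟩ + scrollPoint ⟨j, q.succ⟩ =
      scrollPoint ⟨j, q.castSucc⟩ + scrollPoint ⟨i, p.succ⟩ := by
  refine Subtype.ext (Prod.ext (add_comm _ _) ?_)
  change (p : ℕ) + (q + 1) = q + (p + 1)
  ring

variable (k n) in
/-- The monomial parametrization of the scroll: a variable is sent to its multidegree. -/
def scrollParametrization :
    MvPolynomial (ScrollVar n) k →ₐ[k] AddMonoidAlgebra k (scrollMonoid n) :=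
  MvPolynomial.aeval fun v => AddMonoidAlgebra.single (scrollPoint v) 1

theorem scrollParametrization_X (v : ScrollVar n) :
    scrollParametrization k n (MvPolynomial.X v) = AddMonoidAlgebra.single (scrollPoint v) 1 :=
  MvPolynomial.aeval_X _ _

theorem scrollParametrization_eq_zero (f : MvPolynomial (ScrollVar n) k)
    (hf : f ∈ idealOfTwoMinors (scrollMatrix k n)) : scrollParametrization k n f = 0 := by
  suffices h : idealOfTwoMinors (scrollMatrix k n) ≤ RingHom.ker (scrollParametrization k n) from
    h hf
  refine Ideal.span_le.2 ?_
  rintro _ ⟨⟨i, p⟩, ⟨j, q⟩, rfl⟩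
  rw [SetLike.mem_coe, RingHom.mem_ker, Matrix.det_fin_two]
  simp only [scrollMatrix, Matrix.submatrix_apply, id_eq, Matrix.cons_val_zero, Matrix.cons_val_one,
    Matrix.of_apply, map_sub, map_mul, scrollParametrization_X, AddMonoidAlgebra.single_mul_single]
  rw [scrollPoint_castSucc_add_scrollPoint_succ, sub_self]

theorem prod_map_single_scrollPoint (s : Multiset (ScrollVar n)) :
    (s.map fun v => AddMonoidAlgebra.single (R := k) (scrollPoint v) 1).prod =
      AddMonoidAlgebra.single (s.map scrollPoint).sum 1 := by
  induction s using Multiset.induction_on with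
  | empty => rfl
  | cons v s ih => simp [ih, AddMonoidAlgebra.single_mul_single]

theorem prod_map_scrollCoordinate_eq {s s' : Multiset (ScrollVar n)}
    (h : (s.map scrollPoint).sum = (s'.map scrollPoint).sum) :
    (s.map (scrollCoordinate k)).prod = (s'.map (scrollCoordinate k)).prod := by
  have hval := congrArg Subtype.val h
  rw [coe_sum_map_scrollPoint, coe_sum_map_scrollPoint, Prod.mk.injEq] at hval
  exact isScrollFamily_scrollCoordinate.prod_map_eq_prod_map hval.1 hval.2

variable (k n) in
/-- The class of the monomials with a given multidegree. -/
def scrollMonomial : Multiplicative (scrollMonoid n) →* Scroll k n where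
  toFun x :=
    ((Function.surjInv sum_map_scrollPoint_surjective x.toAdd).map (scrollCoordinate k)).prod
  map_one' := prod_map_scrollCoordinate_eq (s' := 0) <|
    Function.surjInv_eq sum_map_scrollPoint_surjective _
  map_mul' x y := by
    rw [← Multiset.prod_add, ← Multiset.map_add]
    refine prod_map_scrollCoordinate_eq ?_
    rw [Multiset.map_add, Multiset.sum_add]
    simp only [Function.surjInv_eq sum_map_scrollPoint_surjective, toAdd_mul]

theorem scrollMonomial_sum (s : Multiset (ScrollVar n)) :
    scrollMonomial k n (Multiplicative.ofAdd (s.map scrollPoint).sum) =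
      (s.map (scrollCoordinate k)).prod :=
  prod_map_scrollCoordinate_eq <| Function.surjInv_eq sum_map_scrollPoint_surjective _

theorem scrollMonomial_scrollPoint (v : ScrollVar n) :
    scrollMonomial k n (Multiplicative.ofAdd (scrollPoint v)) = scrollCoordinate k v := by
  simpa using scrollMonomial_sum (k := k) {v}

variable (k n) in
/-- The scroll is the monoid algebra of the monoid of its multidegrees. -/
def scrollEquiv : Scroll k n ≃ₐ[k] AddMonoidAlgebra k (scrollMonoid n) :=
  AlgEquiv.ofAlgHom
    (Ideal.Quotient.liftₐ _ (scrollParametrization k n) scrollParametrization_eq_zero)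
    (AddMonoidAlgebra.lift k (Scroll k n) (scrollMonoid n) (scrollMonomial k n))
    (by
      refine AddMonoidAlgebra.algHom_ext (fun x => ?_) (Subsingleton.elim _ _)
      obtain ⟨s, rfl⟩ := sum_map_scrollPoint_surjective x
      rw [AlgHom.comp_apply, AddMonoidAlgebra.lift_single, one_smul, scrollMonomial_sum,
        map_multiset_prod, Multiset.map_map, AlgHom.id_apply, ← prod_map_single_scrollPoint]
      exact congrArg Multiset.prod (Multiset.map_congr rfl fun v _ => scrollParametrization_X v))
    (by
      refine Ideal.Quotient.algHom_ext _ (MvPolynomial.algHom_ext fun v => ?_)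
      change AddMonoidAlgebra.lift k (Scroll k n) (scrollMonoid n) (scrollMonomial k n)
        (scrollParametrization k n (MvPolynomial.X v)) = scrollCoordinate k v
      rw [scrollParametrization_X, AddMonoidAlgebra.lift_single, one_smul,
        scrollMonomial_scrollPoint])

theorem scrollEquiv_scrollCoordinate (v : ScrollVar n) :
    scrollEquiv k n (scrollCoordinate k v) = AddMonoidAlgebra.single (scrollPoint v) 1 :=
  scrollParametrization_X v

theorem scrollParametrization_monomial (d : ScrollVar n →₀ ℕ) (c : k) :
    scrollParametrization k n (MvPolynomial.monomial d c) =
      AddMonoidAlgebra.single (d.toMultiset.map scrollPoint).sum c := by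
  classical
  rw [scrollParametrization, MvPolynomial.aeval_monomial, ← Algebra.smul_def, Finsupp.prod,
    ← Finsupp.toFinset_toMultiset]
  simp only [← Finsupp.count_toMultiset]
  rw [← Finset.prod_multiset_map_count, prod_map_single_scrollPoint, AddMonoidAlgebra.smul_single',
    mul_one]

end ScrollAlgebra

section ScrollGrading

variable {k : Type u} [CommRing k] {t : ℕ} {n : Fin t → ℕ}

theorem scrollDegree_sum_map_scrollPoint_toMultiset (d : ScrollVar n →₀ ℕ) :
    scrollDegree n (d.toMultiset.map scrollPoint).sum = d.degree := by
  rw [scrollDegree_sum_map_scrollPoint, Finsupp.card_toMultiset]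
  rfl

theorem scrollEquiv_mem_gradeBy {j : ℤ} {a : Scroll k n} (ha : a ∈ scrollGrading k n j) :
    scrollEquiv k n a ∈ AddMonoidAlgebra.gradeBy k (scrollDegree n) j := by
  obtain ⟨f, hf, rfl⟩ := ha
  change scrollParametrization k n f ∈ _
  obtain m | m := j
  · have hf : f.IsHomogeneous m := hf
    rw [f.as_sum, map_sum]
    refine Submodule.sum_mem _ fun d hd => ?_
    have hdeg : scrollDegree n (d.toMultiset.map scrollPoint).sum = m := by
      rw [scrollDegree_sum_map_scrollPoint_toMultiset, Finsupp.degree_eq_weight_one,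
        ← hf (MvPolynomial.mem_support_iff.1 hd)]
      rfl
    rw [scrollParametrization_monomial, Int.ofNat_eq_natCast, ← hdeg]
    exact AddMonoidAlgebra.single_mem_gradeBy _ _ _
  · rw [(Submodule.mem_bot k).1 hf, map_zero]
    exact Submodule.zero_mem _

theorem scrollEquiv_symm_single_mem (x : scrollMonoid n) (c : k) :
    (scrollEquiv k n).symm (AddMonoidAlgebra.single x c) ∈
      scrollGrading k n (scrollDegree n x) := by
  classical
  obtain ⟨s, rfl⟩ := sum_map_scrollPoint_surjective x
  obtain ⟨d, rfl⟩ : ∃ d : ScrollVar n →₀ ℕ, d.toMultiset = s := ⟨_, Multiset.toFinsupp_toMultiset s⟩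
  refine ⟨MvPolynomial.monomial d c, ?_, ?_⟩
  · dsimp only
    rw [scrollDegree_sum_map_scrollPoint_toMultiset]
    exact MvPolynomial.isHomogeneous_monomial c rfl
  · rw [AlgEquiv.eq_symm_apply]
    exact scrollParametrization_monomial d c

theorem eq_sum_scrollEquiv_symm_single (a : Scroll k n) :
    a = ∑ x ∈ (scrollEquiv k n a).coeff.support,
      (scrollEquiv k n).symm (AddMonoidAlgebra.single x ((scrollEquiv k n a).coeff x)) := by
  rw [← map_sum, AlgEquiv.eq_symm_apply]
  exact (AddMonoidAlgebra.sum_coeff_single _).symm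

theorem mem_scrollGrading_iff (j : ℤ) (a : Scroll k n) :
    a ∈ scrollGrading k n j ↔
      scrollEquiv k n a ∈ AddMonoidAlgebra.gradeBy k (scrollDegree n) j := by
  refine ⟨scrollEquiv_mem_gradeBy, fun ha => ?_⟩
  rw [eq_sum_scrollEquiv_symm_single a]
  refine Submodule.sum_mem _ fun x hx => ?_
  rw [← show scrollDegree n x = j from ha x hx]
  exact scrollEquiv_symm_single_mem x _

instance scrollGrading.gradedMonoid : SetLike.GradedMonoid (scrollGrading k n) where
  one_mem := by
    rw [mem_scrollGrading_iff, map_one]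
    exact SetLike.GradedOne.one_mem
  mul_mem i j a b ha hb := by
    rw [mem_scrollGrading_iff] at ha hb ⊢
    rw [map_mul]
    exact SetLike.GradedMul.mul_mem ha hb

theorem scrollGrading_isInternal : DirectSum.IsInternal (scrollGrading k n) := by
  have h := AddMonoidAlgebra.gradeBy.isInternal (R := k) (scrollDegree n)
  rw [DirectSum.isInternal_submodule_iff_iSupIndep_and_iSup_eq_top] at h ⊢
  let e := Submodule.orderIsoMapComap (scrollEquiv k n).toLinearEquiv
  have he : scrollGrading k n = e.symm ∘ AddMonoidAlgebra.gradeBy k (scrollDegree n) :=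
    funext fun j => Submodule.ext fun a => mem_scrollGrading_iff j a
  rw [he, iSupIndep_map_orderIso_iff]
  refine ⟨h.1, (e.symm.map_iSup _).symm.trans ?_⟩
  rw [h.2, map_top]

instance scrollGrading.gradedAlgebra : GradedAlgebra (scrollGrading k n) where
  toDecomposition := scrollGrading_isInternal.chooseDecomposition

theorem scrollGrading_eq_bot_of_neg (j : ℤ) (hj : j < 0) : scrollGrading k n j = ⊥ := by
  obtain m | m := j
  · exact absurd hj (Int.natCast_nonneg m).not_gt
  · exact Submodule.map_bot _

theorem naturalCoordinates_subset_scrollGrading_one :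
    naturalCoordinates k n ⊆ scrollGrading k n 1 := by
  rintro _ ⟨v, rfl⟩
  exact ⟨MvPolynomial.X v, MvPolynomial.isHomogeneous_X k v, rfl⟩

instance Scroll.nontrivial [Nontrivial k] : Nontrivial (Scroll k n) :=
  (scrollEquiv k n).toEquiv.nontrivial

end ScrollGrading

section ColonIdeals

variable {k : Type u} [CommRing k] {t : ℕ} {n : Fin t → ℕ}

theorem mem_span_scrollCoordinate_iff (Z : Set (ScrollVar n)) (a : Scroll k n) :
    a ∈ Ideal.span (scrollCoordinate k '' Z) ↔
      ∀ x ∈ (scrollEquiv k n a).coeff.support, ∃ v ∈ Z, ∃ d, x = d + scrollPoint v := by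
  have hmap : Ideal.map (scrollEquiv k n) (Ideal.span (scrollCoordinate k '' Z)) =
      Ideal.span (AddMonoidAlgebra.of' k (scrollMonoid n) '' (scrollPoint '' Z)) := by
    rw [Ideal.map_span, Set.image_image, Set.image_image]
    simp only [scrollEquiv_scrollCoordinate, AddMonoidAlgebra.of'_apply]
  have hmem : a ∈ Ideal.span (scrollCoordinate k '' Z) ↔
      scrollEquiv k n a ∈ Ideal.map (scrollEquiv k n) (Ideal.span (scrollCoordinate k '' Z)) := by
    simp [Ideal.mem_map_of_equiv]
  rw [hmem, hmap, AddMonoidAlgebra.mem_ideal_span_of'_image]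
  simp only [Set.exists_mem_image]

theorem mem_colon_span_scrollCoordinate_iff (Z : Set (ScrollVar n)) (w : ScrollVar n)
    (a : Scroll k n) :
    a ∈ (Ideal.span (scrollCoordinate k '' Z)).colon {scrollCoordinate k w} ↔
      ∀ x ∈ (scrollEquiv k n a).coeff.support, ∃ v ∈ Z, ∃ d,
        x + scrollPoint w = d + scrollPoint v := by
  rw [Submodule.mem_colon_singleton, smul_eq_mul, mem_span_scrollCoordinate_iff, map_mul,
    scrollEquiv_scrollCoordinate, AddMonoidAlgebra.support_coeff_mul_single _ _ (by simp)]
  simp only [Finset.mem_map, forall_exists_index, and_imp, forall_apply_eq_imp_iff₂,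
    addRightEmbedding_apply]

theorem hasLinearColonIdeals_naturalCoordinates (hn : ∀ i j, n i = n j) :
    HasLinearColonIdeals (naturalCoordinates k n) := by
  rintro Y hY _ ⟨w, rfl⟩ hw
  obtain ⟨Z, rfl⟩ : ∃ Z, scrollCoordinate k '' Z = Y := Set.subset_range_iff_exists_image_eq.1 hY
  let Z' : Set (ScrollVar n) :=
    {u | ∃ v ∈ Z, ∃ d, scrollPoint u + scrollPoint w = d + scrollPoint v}
  refine ⟨scrollCoordinate k '' Z', Set.image_subset_range _ _, Ideal.ext fun a => ?_⟩
  refine (mem_colon_span_scrollCoordinate_iff Z w a).trans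
    (Iff.trans (forall₂_congr fun x _ => ?_) (mem_span_scrollCoordinate_iff Z' a).symm)
  constructor
  · rintro ⟨v, hv, d, h⟩
    obtain ⟨u, hu, hv'⟩ := exists_scrollPoint_of_add_scrollPoint_eq hn
      (fun hvw => hw ⟨v, hv, congrArg _ hvw⟩) h
    exact ⟨u, ⟨v, hv, hv'⟩, hu⟩
  · rintro ⟨u, ⟨v, hv, d, hu⟩, x', rfl⟩
    exact ⟨v, hv, x' + d, by rw [add_assoc, hu, add_assoc]⟩

theorem colon_span_scrollCoordinate_le_positiveIdeal {Z : Set (ScrollVar n)} {w : ScrollVar n}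
    (hw : w ∉ Z) : (Ideal.span (scrollCoordinate k '' Z)).colon {scrollCoordinate k w} ≤
      positiveIdeal (scrollGrading k n) := by
  intro a ha
  rw [mem_colon_span_scrollCoordinate_iff] at ha
  rw [eq_sum_scrollEquiv_symm_single a]
  refine Ideal.sum_mem _ fun x hx =>
    mem_positiveIdeal_of_mem ?_ (scrollEquiv_symm_single_mem x _)
  obtain ⟨v, hv, d, h⟩ := ha x hx
  have hx₀ : x ≠ 0 := ne_zero_of_add_scrollPoint_eq (ne_of_mem_of_not_mem hv hw) h
  exact (Int.natCast_nonneg _).lt_of_ne' (scrollDegree_eq_zero_iff.not.2 hx₀)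

theorem exists_scrollDegree_le_one_of_mem_span {Z : Set (ScrollVar n)} {w : ScrollVar n}
    {a : Scroll k n} (ha : a ∈ Ideal.span
      {a ∈ (Ideal.span (scrollCoordinate k '' Z)).colon {scrollCoordinate k w} |
        ∃ j ≤ 1, a ∈ scrollGrading k n j})
    {x : scrollMonoid n} (hx : x ∈ (scrollEquiv k n a).coeff.support) :
    ∃ y, scrollDegree n y ≤ 1 ∧ (∃ v ∈ Z, ∃ d, y + scrollPoint w = d + scrollPoint v) ∧
      ∃ x', x = x' + y := by
  let s : Set (scrollMonoid n) :=
    {y | scrollDegree n y ≤ 1 ∧ ∃ v ∈ Z, ∃ d, y + scrollPoint w = d + scrollPoint v}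
  suffices h : Ideal.span {a ∈ (Ideal.span (scrollCoordinate k '' Z)).colon {scrollCoordinate k w} |
      ∃ j ≤ 1, a ∈ scrollGrading k n j} ≤ Ideal.comap (scrollEquiv k n)
        (Ideal.span (AddMonoidAlgebra.of' k (scrollMonoid n) '' s)) by
    obtain ⟨y, ⟨hdeg, hy⟩, hxy⟩ := AddMonoidAlgebra.mem_ideal_span_of'_image.1 (h ha) x hx
    exact ⟨y, hdeg, hy, hxy⟩
  refine Ideal.span_le.2 ?_
  rintro b ⟨hb, j, hj, hbj⟩
  refine AddMonoidAlgebra.mem_ideal_span_of'_image.2 fun y hy =>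
    ⟨y, ⟨?_, (mem_colon_span_scrollCoordinate_iff Z w b).1 hb y hy⟩, 0, (zero_add y).symm⟩
  exact ((mem_scrollGrading_iff j b).1 hbj y hy).trans_le hj

theorem le_of_castelnuovoMumfordRegularity_eq_zero [Nontrivial k] {i l : Fin t} (hi : 1 ≤ n i)
    (hl : 1 ≤ n l)
    (hreg : castelnuovoMumfordRegularity (scrollGrading k n) (quotientGrading (scrollGrading k n)
      (Ideal.span {scrollCoordinate k ⟨i, 0⟩, scrollCoordinate k ⟨i, Fin.last (n i)⟩})) = 0) :
    n i ≤ n l := by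
  let v : ScrollVar n := ⟨i, Fin.last (n i)⟩
  let w : ScrollVar n := ⟨i, 0⟩
  have hvw : v ≠ w := fun h => by
    have := congrArg (fun z : ScrollVar n => (z.2 : ℕ)) h
    simp only [v, w, Fin.val_last, Fin.val_zero] at this
    omega
  have hcolon {v w : ScrollVar n} (hvw : v ≠ w) : (Ideal.span {scrollCoordinate k v}).colon
      {scrollCoordinate k w} ≤ positiveIdeal (scrollGrading k n) := by
    simpa using colon_span_scrollCoordinate_le_positiveIdeal (Set.mem_singleton_iff.not.2 hvw.symm)
  have hle := colon_le_span_of_castelnuovoMumfordRegularity_eq_zero scrollGrading_eq_bot_of_neg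
    (naturalCoordinates_subset_scrollGrading_one ⟨w, rfl⟩)
    (naturalCoordinates_subset_scrollGrading_one ⟨v, rfl⟩)
    (hcolon hvw) (hcolon hvw.symm) hreg
  let x : scrollMonoid n := n i • scrollPoint ⟨l, Fin.last (n l)⟩
  let a : Scroll k n := (scrollEquiv k n).symm (AddMonoidAlgebra.single x 1)
  have hsupp : (scrollEquiv k n a).coeff.support = {x} := by
    rw [AlgEquiv.apply_symm_apply, AddMonoidAlgebra.coeff_single,
      Finsupp.support_single _ one_ne_zero]
  rw [← Set.image_singleton] at hle
  have ha : a ∈ (Ideal.span (scrollCoordinate k '' {v})).colon {scrollCoordinate k w} := by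
    rw [mem_colon_span_scrollCoordinate_iff, hsupp]
    simpa using exists_nsmul_scrollPoint_last_add_eq hl
  obtain ⟨y, hy, ⟨_, rfl, d, hd⟩, x', hx'⟩ :=
    exists_scrollDegree_le_one_of_mem_span (hle ha) (hsupp ▸ Finset.mem_singleton_self x)
  exact le_of_nsmul_scrollPoint_eq_add hy hd hx'

end ColonIdeals

end

theorem proposition6_general {k : Type*} [CommRing k] [Nontrivial k] {t : ℕ} (n : Fin t → ℕ)
    (hn : ∀ i, 1 ≤ n i) :
    (∀ Y ⊆ naturalCoordinates k n,
      castelnuovoMumfordRegularity (scrollGrading k n)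
        (quotientGrading (scrollGrading k n) (Ideal.span Y)) = 0) ↔
      ∀ i j, n i = n j := by
  refine ⟨fun h => ?_, fun h Y hY => ?_⟩
  · have hle : ∀ i j, n i ≤ n j := fun i j =>
      le_of_castelnuovoMumfordRegularity_eq_zero (hn i) (hn j) <|
        h _ (Set.pair_subset ⟨_, rfl⟩ ⟨_, rfl⟩)
    exact fun i j => (hle i j).antisymm (hle j i)
  · exact castelnuovoMumfordRegularity_quotient_span_eq_zero scrollGrading_eq_bot_of_neg
      (Set.finite_range _) naturalCoordinates_subset_scrollGrading_one
      (hasLinearColonIdeals_naturalCoordinates h) hY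

theorem proposition6 {k : Type*} [Field k] {t : ℕ} (ht : 1 ≤ t) (n : Fin t → ℕ)
    (hn : ∀ i, 1 ≤ n i) :
    (∀ Y ⊆ naturalCoordinates k n,
      castelnuovoMumfordRegularity (scrollGrading k n)
        (quotientGrading (scrollGrading k n) (Ideal.span Y)) = 0) ↔
      ∀ i j, n i = n j :=
  proposition6_general n hn
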